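/- Let $\mathcal H$ be a separable real Hilbert space, let $K(u,v)=e^{-\|u-v\|_{\mathcal H}^2}$ for $u,v\in\mathcal H$, and let $\mathcal H_K$ be the reproducing kernel Hilbert space of $K$. Let $(c_s)_{s>0}$ be positive constants. Then there is a constant $c^{(1)}>0$ (deterministic, and not depending on $n$, $N$, $\lambda$ or the data) such that the following holds. Let $n,N\ge 1$ be integers and $\lambda>0$. On a probability space, let $\mathcal A$ be a sub-$\sigma$-algebra, let $x_1,\dots,x_n$ ($\mathcal H$-valued) and $Y_1,\dots,Y_n$ (real-valued) be $\mathcal A$-measurable random variables, and let $x_{N,1},\dots,x_{N,n}$ be $\mathcal H$-valued random variables (the noisy versions of $x_1,\dots,x_n$). Write $\mathbb E_n$ for the conditional expectation given $\mathcal A$. For example, $x_i=x_{\mu_i}$ and $x_{N,i}=x_{\mu_i^N}$ are Hilbertian embeddings of random probability distributions $\mu_i$ and of their empirical counterparts $\mu_i^N$ based on $N$ samples, and $\mathcal A$ is generated by $(\mu_i,Y_i)_{i=1}^n$. Assume the near-unbiased condition: for all $s>0$ there are random $a_{N,i}$, $b_{N,i}$ in $\mathcal H$, $i=1,\dots,n$,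 with $x_{N,i}-x_i=a_{N,i}+b_{N,i}$ such that, conditionally to $\mathcal A$, the pairs $(a_{N,i},b_{N,i})$, $i=1,\dots,n$, are independent and, for all $i$, $$\mathbb E_n\big[\|a_{N,i}\|_{\mathcal H}^s\big]\le \frac{c_s}{N^{s/2}},\qquad \mathbb E_n\big[\|b_{N,i}\|_{\mathcal H}^s\big]\le \frac{c_s}{N^{s}},\qquad \mathbb E_n\big[\langle z,a_{N,i}\rangle_{\mathcal H}\big]=0\ \text{ for every fixed } z\in\mathcal H .$$ Let $\hat f_n$ and $\hat f_{n,N}$ be the kernel ridge regressors, that is, the unique minimizers over $f\in\mathcal H_K$ of $$\frac1n\sum_{i=1}^n (Y_i-f(x_i))^2+\lambda\|f\|_{\mathcal H_K}^2\qquad\text{and}\qquad \frac1n\sum_{i=1}^n (Y_i-f(x_{N,i}))^2+\lambda\|f\|_{\mathcal H_K}^2,$$ respectively. Let $Y_{\max,n}=\max_{i=1,\dots,n}|Y_i|$ and $c_n=\|\hat f_n\|_{\mathcal H_K}$. Then, almost surely, $$\sqrt{\mathbb E_n\big[\|\hat f_n-\hat f_{n,N}\|_{\mathcal H_K}^2\big]}\le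 \frac{c^{(1)}(Y_{\max,n}+c_n)}{\lambda N}+\frac{c^{(1)}(Y_{\max,n}+c_n)}{\lambda\sqrt n\sqrt N}+\Big(1+\frac{\sqrt N}{\sqrt n}\Big)^{-1}\Big(\frac{c^{(1)}(Y_{\max,n}+c_n)}{\lambda n}+\frac{c^{(1)}(Y_{\max,n}+c_n)}{\lambda^2 n\sqrt N}\Big).$$ -/

import Mathlib

open MeasureTheory ProbabilityTheory
open scoped ENNReal InnerProductSpace

noncomputable section

namespace KernelRidge

universe u v

/-! ### The squared exponential kernel on a Hilbert space and its RKHS -/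

section Kernel

variable {H : Type u} [NormedAddCommGroup H] [InnerProductSpace ℝ H]

/-- The squared exponential kernel `K(u, v) = exp (-‖u - v‖ ^ 2)`. -/
def sqExp {H : Type u} [NormedAddCommGroup H] (u v : H) : ℝ := Real.exp (-‖u - v‖ ^ 2)

theorem sqExp_comm {H : Type u} [NormedAddCommGroup H] (u v : H) : sqExp u v = sqExp v u := by
  simp [sqExp, norm_sub_rev u v]

theorem posSemidef_inner_pow (t : Finset H) (k : ℕ) :
    (Matrix.of fun u v : t => ⟪(u : H), (v : H)⟫_ℝ ^ k).PosSemidef := by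
  induction k with
  | zero =>
    have h := Matrix.posSemidef_gram ℝ (fun _ : t => (1 : ℝ))
    have e : Matrix.gram ℝ (fun _ : t => (1 : ℝ))
        = Matrix.of fun u v : t => ⟪(u : H), (v : H)⟫_ℝ ^ 0 := by
      ext u v
      simp
    exact e ▸ h
  | succ k ih =>
    have h := ih.hadamard (Matrix.posSemidef_gram ℝ (fun u : t => (u : H)))
    have e : Matrix.hadamard (Matrix.of fun u v : t => ⟪(u : H), (v : H)⟫_ℝ ^ k)
        (Matrix.gram ℝ (fun u : t => (u : H)))
        = Matrix.of fun u v : t => ⟪(u : H), (v : H)⟫_ℝ ^ (k + 1) := by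
      ext u v
      simp [pow_succ]
    exact e ▸ h

theorem sum_inner_pow_nonneg (k : ℕ) (w : H →₀ ℝ) :
    0 ≤ ∑ u ∈ w.support, ∑ v ∈ w.support, w u * w v * ⟪u, v⟫_ℝ ^ k := by
  have h := (posSemidef_inner_pow w.support k).dotProduct_mulVec_nonneg (fun u => w u)
  refine h.trans_eq ?_
  rw [← Finset.sum_coe_sort]
  simp only [dotProduct, Matrix.mulVec, Matrix.of_apply, Pi.star_apply, star_trivial,
    Finset.mul_sum]
  refine Finset.sum_congr rfl fun u _ => ?_
  rw [← Finset.sum_coe_sort w.support]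
  exact Finset.sum_congr rfl fun v _ => by ring

theorem sum_exp_inner_nonneg (w : H →₀ ℝ) :
    0 ≤ ∑ u ∈ w.support, ∑ v ∈ w.support, w u * w v * Real.exp (2 * ⟪u, v⟫_ℝ) := by
  have h : HasSum (fun k : ℕ => ∑ u ∈ w.support, ∑ v ∈ w.support,
      w u * w v * ((2 * ⟪u, v⟫_ℝ) ^ k / k.factorial))
      (∑ u ∈ w.support, ∑ v ∈ w.support, w u * w v * Real.exp (2 * ⟪u, v⟫_ℝ)) := by
    refine hasSum_sum fun u _ => hasSum_sum fun v _ => HasSum.mul_left _ ?_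
    rw [Real.exp_eq_exp_ℝ]
    exact NormedSpace.expSeries_div_hasSum_exp (2 * ⟪u, v⟫_ℝ)
  refine h.nonneg fun k => ?_
  have h2 : ∑ u ∈ w.support, ∑ v ∈ w.support, w u * w v * ((2 * ⟪u, v⟫_ℝ) ^ k / k.factorial)
      = (2 ^ k / k.factorial) *
        ∑ u ∈ w.support, ∑ v ∈ w.support, w u * w v * ⟪u, v⟫_ℝ ^ k := by
    simp only [Finset.mul_sum]
    exact Finset.sum_congr rfl fun u _ => Finset.sum_congr rfl fun v _ => by ring
  rw [h2]
  exact mul_nonneg (by positivity) (sum_inner_pow_nonneg k w)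

theorem sum_sqExp_nonneg (w : H →₀ ℝ) :
    0 ≤ ∑ u ∈ w.support, ∑ v ∈ w.support, w u * w v * sqExp u v := by
  let e : H → ℝ := fun u => Real.exp (-‖u‖ ^ 2)
  have he : ∀ u, e u ≠ 0 := fun u => (Real.exp_pos _).ne'
  let w' : H →₀ ℝ := Finsupp.onFinset w.support (fun u => w u * e u) (by
    intro u hu
    simp only [Finsupp.mem_support_iff]
    exact left_ne_zero_of_mul hu)
  have hs : w'.support = w.support := by
    ext u
    simp [w', he]
  have h := sum_exp_inner_nonneg w'
  rw [hs] at h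
  refine h.trans_eq ?_
  refine Finset.sum_congr rfl fun u _ => Finset.sum_congr rfl fun v _ => ?_
  have hK : sqExp u v = e u * e v * Real.exp (2 * ⟪u, v⟫_ℝ) := by
    simp only [sqExp, e, ← Real.exp_add]
    congr 1
    rw [@norm_sub_sq ℝ]
    simp
    ring
  simp only [w', Finsupp.onFinset_apply, hK]
  ring

variable (H) in
/-- The squared exponential kernel as an operator-valued kernel, as Mathlib's RKHS library expects:
its entry at `(u, v)` is the multiplication by `K(u, v)` on `ℝ`. -/
def sqExpKernel : Matrix H H (ℝ →L[ℝ] ℝ) :=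
  Matrix.of fun u v => sqExp u v • ContinuousLinearMap.id ℝ ℝ

theorem sqExpKernel_posSemidef : (sqExpKernel H).PosSemidef := by
  have t := (RKHS.posSemidef_tfae (K := sqExpKernel H)).out 0 2
  refine t.mpr ⟨?_, fun w => ?_⟩
  · ext u v
    have h1 : star (ContinuousLinearMap.id ℝ ℝ) = ContinuousLinearMap.id ℝ ℝ :=
      star_one (ℝ →L[ℝ] ℝ)
    simp [sqExpKernel, Matrix.conjTranspose_apply, sqExp_comm v u, h1]
  · have h := sum_sqExp_nonneg w
    refine h.trans_eq ?_
    simp only [Finsupp.sum, sqExpKernel, Matrix.of_apply]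
    rw [Finset.sum_comm]
    simp only [RCLike.re_to_real]
    exact Finset.sum_congr rfl fun u _ => Finset.sum_congr rfl fun v _ => by
      simp; ring

instance : Fact (sqExpKernel H).PosSemidef := ⟨sqExpKernel_posSemidef⟩

variable (H) in
/-- The RKHS of the squared exponential kernel: the completion of the span of the functions
`K(u, ·)`, `u ∈ H`, for the inner product with `⟪K(u, ·), K(v, ·)⟫ = K(u, v)`. Its elements are
functions from `H` to `ℝ`, through Mathlib's `RKHS` instance. -/
abbrev GaussRKHS : Type u := RKHS.OfKernel (sqExpKernel H)

end Kernel

/-! ### Kernel ridge regression -/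

section Ridge

variable {H : Type u} [NormedAddCommGroup H] [InnerProductSpace ℝ H]

/-- The regularized empirical risk
`R(f) = (1 / n) * ∑ i, (y i - f (x i)) ^ 2 + lam * ‖f‖ ^ 2` of `f` in the RKHS. -/
def ridgeRisk {n : ℕ} (lam : ℝ) (x : Fin n → H) (y : Fin n → ℝ) (f : GaussRKHS H) : ℝ :=
  (1 / (n : ℝ)) * ∑ i, (y i - f (x i)) ^ 2 + lam * ‖f‖ ^ 2

/-- The regularized empirical risk has exactly one minimizer. -/
theorem existsUnique_ridge {n : ℕ} {lam : ℝ} (hlam : 0 < lam) (x : Fin n → H) (y : Fin n → ℝ) :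
    ∃! f : GaussRKHS H, ∀ g : GaussRKHS H, ridgeRisk lam x y f ≤ ridgeRisk lam x y g := by
  let k : H → GaussRKHS H := fun u => RKHS.kerFun (GaussRKHS H) u 1
  have hk : ∀ (u : H) (f : GaussRKHS H), ⟪k u, f⟫_ℝ = f u := fun u f => by
    simp [k]
  let B : GaussRKHS H →L[ℝ] GaussRKHS H →L[ℝ] ℝ :=
    lam • (innerₗ (GaussRKHS H)).mkContinuous₂ 1 (fun f g => by
        simpa using abs_real_inner_le_norm f g)
      + (1 / (n : ℝ)) • ∑ i, (innerSL ℝ (k (x i))).smulRight (innerSL ℝ (k (x i)))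
  have hB : ∀ f g, B f g = lam * ⟪f, g⟫_ℝ + (1 / (n : ℝ)) * ∑ i, f (x i) * g (x i) := by
    intro f g
    simp [B, hk]
  have hcoer : IsCoercive B := ⟨lam, hlam, fun f => by
    rw [hB, real_inner_self_eq_norm_mul_norm]
    have : 0 ≤ (1 / (n : ℝ)) * ∑ i, f (x i) * f (x i) :=
      mul_nonneg (by positivity) (Finset.sum_nonneg fun i _ => mul_self_nonneg _)
    linarith [mul_assoc lam ‖f‖ ‖f‖]⟩
  let b : GaussRKHS H := (1 / (n : ℝ)) • ∑ i, y i • k (x i)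
  have hb : ∀ g, ⟪b, g⟫_ℝ = (1 / (n : ℝ)) * ∑ i, y i * g (x i) := by
    intro g
    simp [b, inner_smul_left, sum_inner, hk]
  let f : GaussRKHS H := hcoer.continuousLinearEquivOfBilin.symm b
  have hf : ∀ g, B f g = ⟪b, g⟫_ℝ := by
    intro g
    rw [← hcoer.continuousLinearEquivOfBilin_apply]
    simp [f]
  have key : ∀ g, ridgeRisk lam x y f + lam * ‖g - f‖ ^ 2 ≤ ridgeRisk lam x y g := by
    intro g
    have h1 := hf (g - f)
    rw [hB, hb] at h1
    have h2 : ‖g‖ ^ 2 = ‖f‖ ^ 2 + 2 * ⟪f, g - f⟫_ℝ + ‖g - f‖ ^ 2 := by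
      rw [← norm_add_sq_real]; simp
    have h3 : ∑ i, (y i - g (x i)) ^ 2 = ∑ i, (y i - f (x i)) ^ 2
        + 2 * (∑ i, f (x i) * (g - f) (x i) - ∑ i, y i * (g - f) (x i))
        + ∑ i, ((g - f) (x i)) ^ 2 := by
      rw [← Finset.sum_sub_distrib, Finset.mul_sum, ← Finset.sum_add_distrib,
        ← Finset.sum_add_distrib]
      refine Finset.sum_congr rfl fun i _ => ?_
      rw [RKHS.coe_sub, Pi.sub_apply]
      ring
    have h4 : 0 ≤ (1 / (n : ℝ)) * ∑ i, ((g - f) (x i)) ^ 2 :=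
      mul_nonneg (by positivity) (Finset.sum_nonneg fun i _ => sq_nonneg _)
    unfold ridgeRisk
    rw [h2, h3]
    linarith
  refine ⟨f, fun g => ?_, fun g hg => ?_⟩
  · have := key g
    have : 0 ≤ lam * ‖g - f‖ ^ 2 := by positivity
    linarith
  · have h1 := key g
    have h2 := hg f
    have h3 : ‖g - f‖ ^ 2 = 0 := by
      have : 0 ≤ ‖g - f‖ ^ 2 := by positivity
      by_contra hne
      have : 0 < lam * ‖g - f‖ ^ 2 := mul_pos hlam (lt_of_le_of_ne this (Ne.symm hne))
      linarith
    have h4 : ‖g - f‖ = 0 := by simpa using h3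
    exact sub_eq_zero.mp (norm_eq_zero.mp h4)

/-- The kernel ridge regressor: the unique minimizer over the RKHS of the regularized risk. -/
def ridge {n : ℕ} {lam : ℝ} (hlam : 0 < lam) (x : Fin n → H) (y : Fin n → ℝ) : GaussRKHS H :=
  (existsUnique_ridge hlam x y).choose

end Ridge

/-! ### The near-unbiased condition -/

section NearUnbiased

/-- Independence of `Z 0, ..., Z (n - 1)` conditionally to the σ-algebra `𝒜`: for measurable
`S 0, ..., S (n - 1)`, almost surely `P(∀ i, Z i ∈ S i | 𝒜) = ∏ i, P(Z i ∈ S i | 𝒜)`.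
(Mathlib's `iCondIndepFun` is only available on standard Borel spaces `Ω`.) -/
def CondIndependent {Ω : Type v} {n : ℕ} {E : Type*} [MeasurableSpace E]
    (𝒜 : MeasurableSpace Ω) {mΩ : MeasurableSpace Ω} (P : Measure Ω) (Z : Fin n → Ω → E) : Prop :=
  ∀ S : Fin n → Set E, (∀ i, MeasurableSet (S i)) →
    P⟦⋂ i, Z i ⁻¹' S i | 𝒜⟧ =ᵐ[P] fun ω => ∏ i, (P⟦Z i ⁻¹' S i | 𝒜⟧) ω

variable {H : Type u} [NormedAddCommGroup H] [InnerProductSpace ℝ H] [MeasurableSpace H]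

/-- The near-unbiased condition, with constants `c s`, for the observed covariates `xN i` of the
covariates `x i`, conditionally to the σ-algebra `𝒜`. The conditional expectations of nonnegative
variables are taken in `[0, ∞]`. -/
def NearUnbiased {Ω : Type v} {n : ℕ} (𝒜 : MeasurableSpace Ω) {mΩ : MeasurableSpace Ω}
    (P : Measure Ω) (N : ℕ) (x xN : Fin n → Ω → H) (c : ℝ → ℝ) : Prop :=
  ∀ s : ℝ, 0 < s → ∃ a b : Fin n → Ω → H,
    (∀ i, Measurable[mΩ] (a i)) ∧ (∀ i, Measurable[mΩ] (b i)) ∧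
    (∀ i, ∀ᵐ ω ∂P, xN i ω - x i ω = a i ω + b i ω) ∧
    CondIndependent 𝒜 P (fun i ω => (a i ω, b i ω)) ∧
    (∀ i, ∀ᵐ ω ∂P, condLExp 𝒜 P (fun ω' => ENNReal.ofReal (‖a i ω'‖ ^ s)) ω
      ≤ ENNReal.ofReal (c s / (N : ℝ) ^ (s / 2))) ∧
    (∀ i, ∀ᵐ ω ∂P, condLExp 𝒜 P (fun ω' => ENNReal.ofReal (‖b i ω'‖ ^ s)) ω
      ≤ ENNReal.ofReal (c s / (N : ℝ) ^ s)) ∧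
    (∀ i, ∀ z : H, P[fun ω => ⟪z, a i ω⟫_ℝ | 𝒜] =ᵐ[P] 0)

end NearUnbiased

end KernelRidge

end

open KernelRidge

/-! Write `k u = K(u, ·)` for the feature map and `f`, `f'` for the ridge regressors of the exact and of
the noisy covariates. Strong convexity of the noisy risk gives (`ridge_stability`)

  `lam * ‖f - f'‖ ≤ ‖(1 / n) • ∑ i, ξ i‖`,
  `ξ i = (f (xN i) - Y i) • k (xN i) - (f (x i) - Y i) • k (x i)`.

Here `f` is a function of the exact data, so that given `𝒜` the `ξ i` are independent, and the mean
square of their average is at most the squared bias plus the variance over `n`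
(`integral_norm_average_sq_le`). With `M = Ymax + ‖f‖`, the variance of `ξ i` is of order `M ^ 2 / N`
because the feature map is Lipschitz. The bias is of order `M / N`: it reduces to that of
`k (x + d) - k x` for a displacement `d` with second moment of order `1 / N` and mean of order `1 / N`.
The squared norm of the mean of `k (x + d) - k x` is a double integral of an explicit expression in
the kernel, bounded through `inner_feature_increment_le` by the squares of these two quantities
(`norm_integral_feature_increment_sq_le`). Taking square roots yields the first two terms of the
bound, and the third one is nonnegative. Only the moments of order two of the displacements matter.

Conditioning on `𝒜` is made concrete by a regular conditional law of the displacements, which take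
values in a standard Borel space although `Ω` may be arbitrary (`condLaw`). Under almost every such law
the displacements are pairwise independent (`CondIndependent.ae_indepFun`) and satisfy the moment
bounds, which leaves an estimate for one fixed data set (`lintegral_ridge_error_le`). -/

namespace KernelRidge

/-! ### The feature map and its increments -/

section Feature

variable {H : Type*} [NormedAddCommGroup H] [InnerProductSpace ℝ H]

/-- The canonical feature map `u ↦ K(u, ·)` of the squared exponential kernel. -/
noncomputable def feature (u : H) : GaussRKHS H := RKHS.kerFun (GaussRKHS H) u 1

theorem feature_inner (u : H) (f : GaussRKHS H) : ⟪feature u, f⟫_ℝ = f u := by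
  simp [feature]

theorem inner_feature (u : H) (f : GaussRKHS H) : ⟪f, feature u⟫_ℝ = f u := by
  rw [real_inner_comm, feature_inner]

theorem inner_feature_feature (u v : H) : ⟪feature u, feature v⟫_ℝ = sqExp u v := by
  rw [feature_inner, feature, RKHS.kerFun_apply, RKHS.OfKernel.kernel_ofKernel]
  simp [sqExpKernel]

theorem norm_feature (u : H) : ‖feature u‖ = 1 := by
  have h : ‖feature u‖ ^ 2 = 1 := by
    rw [← real_inner_self_eq_norm_sq, inner_feature_feature]
    simp [sqExp]
  nlinarith [norm_nonneg (feature u)]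

theorem norm_feature_sub_sq_le (u v : H) : ‖feature u - feature v‖ ^ 2 ≤ 2 * ‖u - v‖ ^ 2 := by
  rw [@norm_sub_sq ℝ, norm_feature, norm_feature, RCLike.re_to_real, inner_feature_feature, sqExp]
  nlinarith [Real.add_one_le_exp (-‖u - v‖ ^ 2)]

theorem norm_feature_sub_le (u v : H) : ‖feature u - feature v‖ ≤ 2 * ‖u - v‖ := by
  refine abs_le_of_sq_le_sq' ?_ (by positivity) |>.2
  nlinarith [norm_feature_sub_sq_le u v, sq_nonneg ‖u - v‖]

theorem continuous_feature : Continuous (feature : H → GaussRKHS H) := by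
  refine (LipschitzWith.of_dist_le_mul (K := 2) fun u v => ?_).continuous
  simpa [dist_eq_norm] using norm_feature_sub_le u v

theorem abs_apply_le_norm (f : GaussRKHS H) (u : H) : |f u| ≤ ‖f‖ := by
  rw [← feature_inner]
  simpa [norm_feature] using abs_real_inner_le_norm (feature u) f

/-- Up to a fourth order error, the inner product of two increments of the feature map at a common
point is at most twice that of the damped displacements `exp (-‖d‖ ^ 2) • d`. Since the leading term
is again an inner product, averaging over `d` and `d'` controls the mean increment without
differentiating the feature map. -/
theorem inner_feature_increment_le (x d d' : H) :
    ⟪feature (x + d) - feature x, feature (x + d') - feature x⟫_ℝ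
      ≤ 5 * ‖d‖ ^ 2 * ‖d'‖ ^ 2
        + 2 * ⟪Real.exp (-‖d‖ ^ 2) • d, Real.exp (-‖d'‖ ^ 2) • d'⟫_ℝ := by
  have hK : ⟪feature (x + d) - feature x, feature (x + d') - feature x⟫_ℝ
      = Real.exp (-‖d‖ ^ 2) * Real.exp (-‖d'‖ ^ 2) * Real.exp (2 * ⟪d, d'⟫_ℝ)
        - Real.exp (-‖d‖ ^ 2) - Real.exp (-‖d'‖ ^ 2) + 1 := by
    have h1 : x + d - (x + d') = d - d' := by abel
    have h2 : x - (x + d') = -d' := by abel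
    simp only [inner_sub_left, inner_sub_right, inner_feature_feature, sqExp, h1, h2,
      add_sub_cancel_left, sub_self, norm_neg, norm_zero]
    rw [← Real.exp_add, ← Real.exp_add, @norm_sub_sq ℝ, RCLike.re_to_real]
    have h3 : -(‖d‖ ^ 2 - 2 * ⟪d, d'⟫_ℝ + ‖d'‖ ^ 2)
      = -‖d‖ ^ 2 + -‖d'‖ ^ 2 + 2 * ⟪d, d'⟫_ℝ := by ring
    rw [h3]
    norm_num
    ring
  rw [hK, inner_smul_left, inner_smul_right]
  simp only [conj_trivial]
  set e := Real.exp (-‖d‖ ^ 2) with he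
  set e' := Real.exp (-‖d'‖ ^ 2) with he'
  set t := ⟪d, d'⟫_ℝ with ht
  have e0 : 0 < e := Real.exp_pos _
  have e0' : 0 < e' := Real.exp_pos _
  have e1 : 1 - e ≤ ‖d‖ ^ 2 := by linarith [Real.add_one_le_exp (-‖d‖ ^ 2)]
  have e1' : 1 - e' ≤ ‖d'‖ ^ 2 := by linarith [Real.add_one_le_exp (-‖d'‖ ^ 2)]
  have e2' : 0 ≤ 1 - e' := sub_nonneg.2 (Real.exp_le_one_iff.2 (by simp))
  have htd : |t| ≤ ‖d‖ * ‖d'‖ := abs_real_inner_le_norm d d'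
  have hexp : Real.exp (2 * t) - 1 - 2 * t ≤ 4 * t ^ 2 * Real.exp (2 * |t|) := by
    have h := Complex.norm_exp_sub_sum_le_norm_mul_exp ((2 * t : ℝ) : ℂ) 2
    simp only [Finset.sum_range_succ, Finset.sum_range_zero] at h
    norm_cast at h
    rw [Real.norm_eq_abs, Real.norm_eq_abs] at h
    have h' := (le_abs_self _).trans h
    rw [abs_mul, abs_two, mul_pow 2 |t|, sq_abs] at h'
    norm_num at h'
    linarith
  -- `2 * |t| ≤ ‖d‖ ^ 2 + ‖d'‖ ^ 2`, so the damping absorbs the exponential growth of the remainder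
  have hdamp : e * e' * Real.exp (2 * |t|) ≤ 1 := by
    rw [he, he', ← Real.exp_add, ← Real.exp_add]
    refine Real.exp_le_one_iff.2 ?_
    nlinarith [sq_nonneg (‖d‖ - ‖d'‖)]
  have ht2 : t ^ 2 ≤ ‖d‖ ^ 2 * ‖d'‖ ^ 2 := by
    rw [← sq_abs, ← mul_pow]
    gcongr
  have hrem : e * e' * (Real.exp (2 * t) - 1 - 2 * t) ≤ 4 * (‖d‖ ^ 2 * ‖d'‖ ^ 2) :=
    calc e * e' * (Real.exp (2 * t) - 1 - 2 * t)
        ≤ e * e' * (4 * t ^ 2 * Real.exp (2 * |t|)) := by gcongr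
      _ = 4 * t ^ 2 * (e * e' * Real.exp (2 * |t|)) := by ring
      _ ≤ 4 * t ^ 2 * 1 := by gcongr
      _ ≤ 4 * (‖d‖ ^ 2 * ‖d'‖ ^ 2) := by linarith
  have hprod : (1 - e) * (1 - e') ≤ ‖d‖ ^ 2 * ‖d'‖ ^ 2 := by gcongr
  linarith

end Feature

/-! ### Stability of the kernel ridge regressor -/

section Stability

variable {H : Type*} [NormedAddCommGroup H] [InnerProductSpace ℝ H]

/-- The gradient term `(f(u) - y) K(u, ·)` of the squared loss `(y - f(u)) ^ 2 / 2` of `f` at the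
observation `(u, y)`. -/
noncomputable def lossGrad (f : GaussRKHS H) (y : ℝ) (u : H) : GaussRKHS H :=
  (f u - y) • feature u

theorem continuous_lossGrad {X : Type*} [TopologicalSpace X] (f : GaussRKHS H) {y : X → ℝ}
    {u : X → H} (hy : Continuous y) (hu : Continuous u) :
    Continuous fun t => lossGrad f (y t) (u t) := by
  have hk : Continuous fun t => feature (u t) := continuous_feature.comp hu
  simp only [lossGrad, ← feature_inner]
  exact ((hk.inner continuous_const).sub hy).smul hk

theorem ridge_le {n : ℕ} {lam : ℝ} (hlam : 0 < lam) (x : Fin n → H) (y : Fin n → ℝ)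
    (g : GaussRKHS H) : ridgeRisk lam x y (ridge hlam x y) ≤ ridgeRisk lam x y g :=
  (existsUnique_ridge hlam x y).choose_spec.1 g

/-- First order optimality of the kernel ridge regressor. -/
theorem ridge_normal_equation {n : ℕ} {lam : ℝ} (hlam : 0 < lam) (x : Fin n → H) (y : Fin n → ℝ) :
    (1 / (n : ℝ)) • ∑ i, lossGrad (ridge hlam x y) (y i) (x i) + lam • ridge hlam x y = 0 := by
  set f := ridge hlam x y with hf
  refine ext_inner_right ℝ fun g => ?_
  rw [inner_zero_left]
  set L := ⟪(1 / (n : ℝ)) • ∑ i, lossGrad f (y i) (x i) + lam • f, g⟫_ℝ with hL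
  have hLe : L = (1 / (n : ℝ)) * ∑ i, (f (x i) - y i) * g (x i) + lam * ⟪f, g⟫_ℝ := by
    simp [hL, inner_add_left, inner_smul_left, sum_inner, lossGrad, feature_inner]
  set Q := (1 / (n : ℝ)) * ∑ i, (g (x i)) ^ 2 + lam * ‖g‖ ^ 2 with hQ
  -- the risk along `f + t • g` is a quadratic polynomial in `t` that is minimal at `t = 0`, so that
  -- its linear coefficient `2 * L` vanishes
  have key : ∀ t : ℝ, 0 ≤ Q * (t * t) + (2 * L) * t + 0 := by
    intro t
    have h := ridge_le hlam x y (f + t • g)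
    rw [← hf] at h
    have h1 : ridgeRisk lam x y (f + t • g)
        = ridgeRisk lam x y f + (Q * (t * t) + (2 * L) * t + 0) := by
      have h2 : ∑ i, (y i - (f + t • g) (x i)) ^ 2 = ∑ i, (y i - f (x i)) ^ 2
          + 2 * t * (∑ i, (f (x i) - y i) * g (x i)) + t * t * ∑ i, (g (x i)) ^ 2 := by
        rw [Finset.mul_sum, Finset.mul_sum, ← Finset.sum_add_distrib, ← Finset.sum_add_distrib]
        refine Finset.sum_congr rfl fun i _ => ?_
        simp only [RKHS.coe_add, RKHS.coe_smul, Pi.add_apply, Pi.smul_apply, smul_eq_mul]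
        ring
      rw [ridgeRisk, ridgeRisk, h2, norm_add_sq_real, norm_smul, inner_smul_right, mul_pow,
        Real.norm_eq_abs, sq_abs, hLe, hQ]
      ring
    linarith
  have := discrim_le_zero key
  rw [discrim] at this
  nlinarith [sq_nonneg L]

/-- Strong convexity of the risk: the distance between two ridge regressors is controlled by the
difference of the two mean loss gradients, both taken at the first regressor. As that regressor does
not depend on the second data set, the summands are independent when the `x' i` are. -/
theorem ridge_stability {n : ℕ} {lam : ℝ} (hlam : 0 < lam) (x x' : Fin n → H) (y y' : Fin n → ℝ) :
    lam * ‖ridge hlam x y - ridge hlam x' y'‖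
      ≤ ‖(1 / (n : ℝ)) • ∑ i, (lossGrad (ridge hlam x y) (y' i) (x' i)
          - lossGrad (ridge hlam x y) (y i) (x i))‖ := by
  have h1 := ridge_normal_equation hlam x y
  have h2 := ridge_normal_equation hlam x' y'
  set f := ridge hlam x y
  set f' := ridge hlam x' y'
  rw [Finset.sum_sub_distrib, smul_sub]
  set A := (1 / (n : ℝ)) • ∑ i, lossGrad f (y i) (x i)
  set B := (1 / (n : ℝ)) • ∑ i, lossGrad f (y' i) (x' i) with hB
  set B' := (1 / (n : ℝ)) • ∑ i, lossGrad f' (y' i) (x' i) with hB'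
  -- the loss gradient is monotone in the regressor
  have hmono : 0 ≤ ⟪B - B', f - f'⟫_ℝ := by
    have : ⟪B - B', f - f'⟫_ℝ = (1 / (n : ℝ)) * ∑ i, ((f - f') (x' i)) ^ 2 := by
      rw [hB, hB', ← smul_sub, ← Finset.sum_sub_distrib, inner_smul_left, sum_inner]
      simp only [conj_trivial]
      congr 1
      refine Finset.sum_congr rfl fun i _ => ?_
      rw [lossGrad, lossGrad, ← sub_smul, inner_smul_left, feature_inner, RKHS.coe_sub]
      simp only [Pi.sub_apply, conj_trivial]
      ring
    rw [this]
    positivity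
  have hid : lam • (f - f') = (B - A) - (B - B') := by
    rw [smul_sub, eq_neg_of_add_eq_zero_right h1, eq_neg_of_add_eq_zero_right h2]
    abel
  have h3 : lam * ‖f - f'‖ * ‖f - f'‖ ≤ ‖B - A‖ * ‖f - f'‖ := by
    have : lam * ‖f - f'‖ * ‖f - f'‖ = ⟪lam • (f - f'), f - f'⟫_ℝ := by
      rw [inner_smul_left, real_inner_self_eq_norm_sq]; simp; ring
    rw [this, hid, inner_sub_left]
    linarith [real_inner_le_norm (B - A) (f - f')]
  rcases (norm_nonneg (f - f')).eq_or_lt with h0 | h0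
  · rw [← h0, mul_zero]; exact norm_nonneg _
  · exact le_of_mul_le_mul_right h3 h0

theorem continuous_ridge {n : ℕ} {lam : ℝ} (hlam : 0 < lam) :
    Continuous fun p : (Fin n → H) × (Fin n → ℝ) => ridge hlam p.1 p.2 := by
  refine continuous_iff_continuousAt.2 fun p => ?_
  obtain ⟨f, hf⟩ : ∃ f, f = ridge hlam p.1 p.2 := ⟨_, rfl⟩
  have hg (i : Fin n) :
      Continuous fun q : (Fin n → H) × (Fin n → ℝ) => lossGrad f (q.2 i) (q.1 i) :=
    continuous_lossGrad f (by fun_prop) (by fun_prop)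
  have hsum : Continuous fun q : (Fin n → H) × (Fin n → ℝ) =>
      ∑ i, (lossGrad f (q.2 i) (q.1 i) - lossGrad f (p.2 i) (p.1 i)) :=
    continuous_finsetSum _ fun i _ => (hg i).sub continuous_const
  have hD : Continuous fun q : (Fin n → H) × (Fin n → ℝ) => lam⁻¹ *
      ‖(1 / (n : ℝ)) • ∑ i, (lossGrad f (q.2 i) (q.1 i) - lossGrad f (p.2 i) (p.1 i))‖ :=
    continuous_const.mul (hsum.const_smul (1 / (n : ℝ))).norm
  have hDp := hD.tendsto p
  simp only [sub_self, Finset.sum_const_zero, smul_zero, norm_zero, mul_zero] at hDp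
  refine tendsto_iff_norm_sub_tendsto_zero.2 ?_
  refine squeeze_zero (fun _ => norm_nonneg _) (fun q => ?_) hDp
  rw [norm_sub_rev, ← div_eq_inv_mul, le_div_iff₀' hlam, hf]
  exact ridge_stability hlam p.1 q.1 p.2 q.2

end Stability

/-! ### Bias and variance of the increments of the loss gradient -/

section Moments

variable {H : Type*} [NormedAddCommGroup H] [InnerProductSpace ℝ H]
  {Θ : Type*} [MeasurableSpace Θ] {ν : Measure Θ} {δ : Θ → H}

theorem integrable_of_integrable_norm_sq [IsProbabilityMeasure ν] {F : Type*}
    [NormedAddCommGroup F] {ψ : Θ → F}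
    (hψ : AEStronglyMeasurable ψ ν) (h2 : Integrable (fun z => ‖ψ z‖ ^ 2) ν) :
    Integrable ψ ν :=
  ((memLp_two_iff_integrable_sq_norm hψ).2 h2).integrable one_le_two

theorem norm_integral_sq_le [IsProbabilityMeasure ν] [CompleteSpace H] {b : Θ → H}
    (hb : AEStronglyMeasurable b ν)
    (h2 : Integrable (fun z => ‖b z‖ ^ 2) ν) : ‖∫ z, b z ∂ν‖ ^ 2 ≤ ∫ z, ‖b z‖ ^ 2 ∂ν := by
  have hi := integrable_of_integrable_norm_sq hb h2
  have h : ∫ z, 2 * ⟪∫ z, b z ∂ν, b z⟫_ℝ ∂ν ≤ ∫ z, (‖∫ z, b z ∂ν‖ ^ 2 + ‖b z‖ ^ 2) ∂ν := by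
    refine integral_mono ((hi.const_inner _).const_mul 2) ((integrable_const _).add h2) fun z => ?_
    have := real_inner_le_norm (∫ z, b z ∂ν) (b z)
    simp only
    nlinarith [sq_nonneg (‖∫ z, b z ∂ν‖ - ‖b z‖)]
  rw [integral_const_mul, integral_inner hi, real_inner_self_eq_norm_sq,
    integral_add (integrable_const _) h2] at h
  simp at h
  linarith

theorem aestronglyMeasurable_feature_increment (x : H) (hδ : AEStronglyMeasurable δ ν) :
    AEStronglyMeasurable (fun z => feature (x + δ z) - feature x) ν :=
  (continuous_feature.comp_aestronglyMeasurable (hδ.const_add x)).sub aestronglyMeasurable_const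

theorem norm_feature_increment_sq_le (x d : H) :
    ‖feature (x + d) - feature x‖ ^ 2 ≤ 2 * ‖d‖ ^ 2 := by
  simpa using norm_feature_sub_sq_le (x + d) x

theorem integrable_norm_feature_increment_sq (x : H) (hδ : AEStronglyMeasurable δ ν)
    (h2 : Integrable (fun z => ‖δ z‖ ^ 2) ν) :
    Integrable (fun z => ‖feature (x + δ z) - feature x‖ ^ 2) ν := by
  refine (h2.const_mul 2).mono' ((aestronglyMeasurable_feature_increment x hδ).norm.pow 2)
    (.of_forall fun z => ?_)
  rw [Real.norm_of_nonneg (by positivity)]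
  exact norm_feature_increment_sq_le x (δ z)

/-- Damping changes a displacement by a second order term only. -/
theorem norm_exp_smul_sub_le (d : H) : ‖Real.exp (-‖d‖ ^ 2) • d - d‖ ≤ ‖d‖ ^ 2 := by
  have h1 : 0 ≤ 1 - Real.exp (-‖d‖ ^ 2) := sub_nonneg.2 (Real.exp_le_one_iff.2 (by simp))
  have h2 : 1 - Real.exp (-‖d‖ ^ 2) ≤ ‖d‖ ^ 2 := by linarith [Real.add_one_le_exp (-‖d‖ ^ 2)]
  have h3 : 1 - Real.exp (-‖d‖ ^ 2) ≤ 1 := by linarith [Real.exp_pos (-‖d‖ ^ 2)]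
  have h4 : Real.exp (-‖d‖ ^ 2) • d - d = -((1 - Real.exp (-‖d‖ ^ 2)) • d) := by
    rw [sub_smul, one_smul]; abel
  rw [h4, norm_neg, norm_smul, Real.norm_of_nonneg h1]
  rcases le_total ‖d‖ 1 with h | h
  · nlinarith [norm_nonneg d]
  · nlinarith [norm_nonneg d]

/-- The mean increment of the feature map is of the order of the second moment and of the norm of
the mean of the displacement: the first order fluctuations cancel. -/
theorem norm_integral_feature_increment_sq_le [IsProbabilityMeasure ν] [CompleteSpace H] {A B : ℝ} (x : H)
    (hδ : AEStronglyMeasurable δ ν) (h2 : Integrable (fun z => ‖δ z‖ ^ 2) ν)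
    (hA : ∫ z, ‖δ z‖ ^ 2 ∂ν ≤ A) (hB : ‖∫ z, δ z ∂ν‖ ≤ B) :
    ‖∫ z, (feature (x + δ z) - feature x) ∂ν‖ ^ 2 ≤ 5 * A ^ 2 + 2 * (A + B) ^ 2 := by
  have hδ1 := integrable_of_integrable_norm_sq hδ h2
  have hψ : Integrable (fun z => feature (x + δ z) - feature x) ν :=
    integrable_of_integrable_norm_sq (aestronglyMeasurable_feature_increment x hδ)
      (integrable_norm_feature_increment_sq x hδ h2)
  have hem : AEStronglyMeasurable (fun z => Real.exp (-‖δ z‖ ^ 2) • δ z) ν :=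
    (by fun_prop : Continuous fun d : H => Real.exp (-‖d‖ ^ 2) • d).comp_aestronglyMeasurable hδ
  have hediff : Integrable (fun z => Real.exp (-‖δ z‖ ^ 2) • δ z - δ z) ν :=
    h2.mono' (hem.sub hδ) (.of_forall fun z => norm_exp_smul_sub_le (δ z))
  have he : Integrable (fun z => Real.exp (-‖δ z‖ ^ 2) • δ z) ν :=
    (hediff.add hδ1).congr (.of_forall fun z => by simp)
  set I := ∫ z, (feature (x + δ z) - feature x) ∂ν with hI
  set J := ∫ z, Real.exp (-‖δ z‖ ^ 2) • δ z ∂ν with hJ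
  set A' := ∫ z, ‖δ z‖ ^ 2 ∂ν with hA'
  have hA0 : 0 ≤ A' := integral_nonneg fun z => by positivity
  have hJle : ‖J‖ ≤ A + B := by
    have h1 : J = ∫ z, (Real.exp (-‖δ z‖ ^ 2) • δ z - δ z) ∂ν + ∫ z, δ z ∂ν := by
      rw [integral_sub he hδ1, sub_add_cancel]
    rw [h1]
    refine (norm_add_le _ _).trans (add_le_add (le_trans ?_ hA) hB)
    exact norm_integral_le_of_norm_le h2 (.of_forall fun z => norm_exp_smul_sub_le (δ z))
  -- `‖I‖ ^ 2` is the double integral of the inner products of two increments; integrate out one of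
  -- the two variables
  have hstep (z : Θ) : ⟪feature (x + δ z) - feature x, I⟫_ℝ
      ≤ 5 * A' * ‖δ z‖ ^ 2 + 2 * ⟪J, Real.exp (-‖δ z‖ ^ 2) • δ z⟫_ℝ := by
    have hint : Integrable (fun z' => 5 * ‖δ z‖ ^ 2 * ‖δ z'‖ ^ 2
        + 2 * ⟪Real.exp (-‖δ z‖ ^ 2) • δ z, Real.exp (-‖δ z'‖ ^ 2) • δ z'⟫_ℝ) ν :=
      (h2.const_mul _).add ((he.const_inner _).const_mul 2)
    rw [hI, ← integral_inner hψ]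
    refine (integral_mono (hψ.const_inner _) hint
      fun z' => inner_feature_increment_le x (δ z) (δ z')).trans_eq ?_
    rw [integral_add (h2.const_mul _) ((he.const_inner _).const_mul 2), integral_const_mul,
      integral_const_mul, integral_inner he, real_inner_comm J]
    ring
  have hII : ‖I‖ ^ 2 = ∫ z, ⟪I, feature (x + δ z) - feature x⟫_ℝ ∂ν := by
    rw [integral_inner hψ, real_inner_self_eq_norm_sq]
  have hfin : ‖I‖ ^ 2 ≤ 5 * A' * A' + 2 * ‖J‖ ^ 2 := by
    rw [hII]
    have hint : Integrable (fun z => 5 * A' * ‖δ z‖ ^ 2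
        + 2 * ⟪J, Real.exp (-‖δ z‖ ^ 2) • δ z⟫_ℝ) ν :=
      (h2.const_mul _).add ((he.const_inner _).const_mul 2)
    refine (integral_mono (hψ.const_inner _) hint fun z => ?_).trans_eq ?_
    · simpa only [real_inner_comm] using hstep z
    · rw [integral_add (h2.const_mul _) ((he.const_inner _).const_mul 2), integral_const_mul,
        integral_const_mul, integral_inner he, real_inner_self_eq_norm_sq]
  have hAA : A' * A' ≤ A ^ 2 := by nlinarith
  have hJJ : ‖J‖ ^ 2 ≤ (A + B) ^ 2 := by gcongr
  linarith

/-- The increment of the loss gradient in terms of that of the feature map; in the second term, the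
feature is taken at the displaced point. -/
theorem lossGrad_increment_eq (f : GaussRKHS H) (y : ℝ) (x d : H) :
    lossGrad f y (x + d) - lossGrad f y x
      = (f x - y) • (feature (x + d) - feature x)
        + ⟪f, feature (x + d) - feature x⟫_ℝ • feature (x + d) := by
  rw [inner_sub_right, inner_feature, inner_feature, lossGrad, lossGrad]
  module

theorem norm_lossGrad_increment_le {M : ℝ} (f : GaussRKHS H) {y : ℝ} (hM : |y| + ‖f‖ ≤ M)
    (x d : H) :
    ‖lossGrad f y (x + d) - lossGrad f y x‖ ≤ 2 * M * ‖feature (x + d) - feature x‖ := by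
  have h1 : |f x - y| ≤ M := by
    linarith [abs_sub (f x) y, abs_apply_le_norm f x]
  have h2 : |⟪f, feature (x + d) - feature x⟫_ℝ| ≤ ‖f‖ * ‖feature (x + d) - feature x‖ :=
    abs_real_inner_le_norm _ _
  have h3 : ‖f‖ ≤ M := by linarith [abs_nonneg y]
  rw [lossGrad_increment_eq]
  refine (norm_add_le _ _).trans ?_
  rw [norm_smul, norm_smul, norm_feature, Real.norm_eq_abs, Real.norm_eq_abs]
  nlinarith [norm_nonneg (feature (x + d) - feature x)]

theorem norm_lossGrad_increment_sq_le {M : ℝ} (f : GaussRKHS H) {y : ℝ} (hM : |y| + ‖f‖ ≤ M)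
    (x d : H) :
    ‖lossGrad f y (x + d) - lossGrad f y x‖ ^ 2 ≤ 8 * M ^ 2 * ‖d‖ ^ 2 := by
  calc ‖lossGrad f y (x + d) - lossGrad f y x‖ ^ 2
      ≤ (2 * M * ‖feature (x + d) - feature x‖) ^ 2 := by
        gcongr; exact norm_lossGrad_increment_le f hM x d
    _ = 4 * M ^ 2 * ‖feature (x + d) - feature x‖ ^ 2 := by ring
    _ ≤ 4 * M ^ 2 * (2 * ‖d‖ ^ 2) := by gcongr; exact norm_feature_increment_sq_le x d
    _ = 8 * M ^ 2 * ‖d‖ ^ 2 := by ring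

theorem aestronglyMeasurable_lossGrad_increment (f : GaussRKHS H) (y : ℝ) (x : H)
    (hδ : AEStronglyMeasurable δ ν) :
    AEStronglyMeasurable (fun z => lossGrad f y (x + δ z) - lossGrad f y x) ν :=
  ((continuous_lossGrad f continuous_const continuous_id).comp_aestronglyMeasurable
    (hδ.const_add x)).sub aestronglyMeasurable_const

theorem integrable_norm_lossGrad_increment_sq (f : GaussRKHS H) (y : ℝ) (x : H)
    (hδ : AEStronglyMeasurable δ ν) (h2 : Integrable (fun z => ‖δ z‖ ^ 2) ν) :
    Integrable (fun z => ‖lossGrad f y (x + δ z) - lossGrad f y x‖ ^ 2) ν := by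
  refine (h2.const_mul (8 * (|y| + ‖f‖) ^ 2)).mono'
    ((aestronglyMeasurable_lossGrad_increment f y x hδ).norm.pow 2) (.of_forall fun z => ?_)
  rw [Real.norm_of_nonneg (by positivity)]
  exact norm_lossGrad_increment_sq_le f le_rfl x (δ z)

theorem integral_norm_lossGrad_increment_sq_le {M A : ℝ} (f : GaussRKHS H) {y : ℝ}
    (hM : |y| + ‖f‖ ≤ M) (x : H) (hδ : AEStronglyMeasurable δ ν)
    (h2 : Integrable (fun z => ‖δ z‖ ^ 2) ν) (hA : ∫ z, ‖δ z‖ ^ 2 ∂ν ≤ A) :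
    ∫ z, ‖lossGrad f y (x + δ z) - lossGrad f y x‖ ^ 2 ∂ν ≤ 8 * M ^ 2 * A := by
  refine (integral_mono (integrable_norm_lossGrad_increment_sq f y x hδ h2)
    (h2.const_mul (8 * M ^ 2)) fun z => norm_lossGrad_increment_sq_le f hM x (δ z)).trans ?_
  rw [integral_const_mul]
  gcongr

/-- Bias of the loss gradient: the linear parts of its increment are controlled by the mean
increment of the feature map, the quadratic part by the second moment of the displacement. -/
theorem norm_integral_lossGrad_increment_le [IsProbabilityMeasure ν] [CompleteSpace H]
    {M A B : ℝ} (f : GaussRKHS H)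
    {y : ℝ} (hM : |y| + ‖f‖ ≤ M) (x : H) (hδ : AEStronglyMeasurable δ ν)
    (h2 : Integrable (fun z => ‖δ z‖ ^ 2) ν)
    (hA : ∫ z, ‖δ z‖ ^ 2 ∂ν ≤ A) (hB : ‖∫ z, δ z ∂ν‖ ≤ B) :
    ‖∫ z, (lossGrad f y (x + δ z) - lossGrad f y x) ∂ν‖
      ≤ 2 * M * (√(5 * A ^ 2 + 2 * (A + B) ^ 2) + A) := by
  have hψ2 := integrable_norm_feature_increment_sq x hδ h2
  have hψm := aestronglyMeasurable_feature_increment x hδ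
  have hψ := integrable_of_integrable_norm_sq hψm hψ2
  have hI := Real.le_sqrt_of_sq_le (norm_integral_feature_increment_sq_le x hδ h2 hA hB)
  set S := √(5 * A ^ 2 + 2 * (A + B) ^ 2)
  set I := ∫ z, (feature (x + δ z) - feature x) ∂ν with hIdef
  have h1 : |f x - y| ≤ M := by
    linarith [abs_sub (f x) y, abs_apply_le_norm f x]
  have h3 : ‖f‖ ≤ M := by linarith [abs_nonneg y]
  have hM0 : 0 ≤ M := (norm_nonneg f).trans h3
  let ψ : Θ → GaussRKHS H := fun z => feature (x + δ z) - feature x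
  have hdec (z : Θ) : lossGrad f y (x + δ z) - lossGrad f y x
      = ((f x - y) • ψ z + ⟪f, ψ z⟫_ℝ • feature x) + ⟪f, ψ z⟫_ℝ • ψ z := by
    rw [lossGrad_increment_eq]
    simp only [ψ]
    module
  have hquad (z : Θ) : ‖⟪f, ψ z⟫_ℝ • ψ z‖ ≤ 2 * M * ‖δ z‖ ^ 2 := by
    rw [norm_smul, Real.norm_eq_abs]
    calc |⟪f, ψ z⟫_ℝ| * ‖ψ z‖ ≤ (‖f‖ * ‖ψ z‖) * ‖ψ z‖ := by
          gcongr; exact abs_real_inner_le_norm _ _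
      _ = ‖f‖ * ‖ψ z‖ ^ 2 := by ring
      _ ≤ M * (2 * ‖δ z‖ ^ 2) := by gcongr; exact norm_feature_increment_sq_le x (δ z)
      _ = 2 * M * ‖δ z‖ ^ 2 := by ring
  have hi1 : Integrable (fun z => (f x - y) • ψ z) ν := hψ.smul (f x - y)
  have hi2 : Integrable (fun z => ⟪f, ψ z⟫_ℝ • feature x) ν := (hψ.const_inner f).smul_const _
  have hi3 : Integrable (fun z => ⟪f, ψ z⟫_ℝ • ψ z) ν :=
    (h2.const_mul (2 * M)).mono'
      ((Integrable.const_inner (𝕜 := ℝ) f hψ).1.smul hψm) (.of_forall hquad)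
  have hint1 : ‖∫ z, (f x - y) • ψ z ∂ν‖ ≤ M * S := by
    rw [integral_smul, norm_smul, Real.norm_eq_abs]
    exact mul_le_mul h1 hI (norm_nonneg _) hM0
  have hint2 : ‖∫ z, ⟪f, ψ z⟫_ℝ • feature x ∂ν‖ ≤ M * S := by
    rw [integral_smul_const, norm_smul, norm_feature, mul_one, integral_inner hψ, Real.norm_eq_abs]
    exact (abs_real_inner_le_norm _ _).trans (mul_le_mul h3 hI (norm_nonneg _) hM0)
  have hint3 : ‖∫ z, ⟪f, ψ z⟫_ℝ • ψ z ∂ν‖ ≤ 2 * M * A := by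
    refine (norm_integral_le_of_norm_le (h2.const_mul (2 * M)) (.of_forall hquad)).trans ?_
    rw [integral_const_mul]
    gcongr
  simp only [hdec]
  have hi12 : Integrable (fun z => (f x - y) • ψ z + ⟪f, ψ z⟫_ℝ • feature x) ν := hi1.add hi2
  rw [integral_add hi12 hi3, integral_add hi1 hi2]
  refine (norm_add₃_le).trans ?_
  linarith

end Moments

/-! ### Averages of pairwise uncorrelated vectors -/

section IndependentMean

variable {F : Type*} [NormedAddCommGroup F] [InnerProductSpace ℝ F]
  {Θ : Type*} [MeasurableSpace Θ] {ν : Measure Θ}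

/-- Second moment of the average of pairwise uncorrelated vectors: bias squared plus variance. -/
theorem integral_norm_average_sq_le {n : ℕ} (hn : 0 < n) {ξ : Fin n → Θ → F} {β σ2 : ℝ}
    (hξ : ∀ i, AEStronglyMeasurable (ξ i) ν) (h2 : ∀ i, Integrable (fun z => ‖ξ i z‖ ^ 2) ν)
    (hcov : ∀ i j, i ≠ j → ∫ z, ⟪ξ i z, ξ j z⟫_ℝ ∂ν = ⟪∫ z, ξ i z ∂ν, ∫ z, ξ j z ∂ν⟫_ℝ)
    (hβ : ∀ i, ‖∫ z, ξ i z ∂ν‖ ≤ β) (hσ : ∀ i, ∫ z, ‖ξ i z‖ ^ 2 ∂ν ≤ σ2) :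
    ∫ z, ‖(1 / (n : ℝ)) • ∑ i, ξ i z‖ ^ 2 ∂ν ≤ β ^ 2 + σ2 / n := by
  have hn' : (0 : ℝ) < n := by exact_mod_cast hn
  have hint (i j : Fin n) : Integrable (fun z => ⟪ξ i z, ξ j z⟫_ℝ) ν := by
    refine ((h2 i).add (h2 j)).mono' ((hξ i).inner (hξ j)) (.of_forall fun z => ?_)
    rw [Real.norm_eq_abs]
    have := abs_real_inner_le_norm (ξ i z) (ξ j z)
    simp only [Pi.add_apply]
    nlinarith [sq_nonneg (‖ξ i z‖ - ‖ξ j z‖), sq_nonneg (‖ξ i z‖ + ‖ξ j z‖)]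
  have hβ0 : 0 ≤ β := (norm_nonneg _).trans (hβ ⟨0, hn⟩)
  have hterm (i j : Fin n) :
      ∫ z, ⟪ξ i z, ξ j z⟫_ℝ ∂ν ≤ β ^ 2 + if i = j then σ2 else 0 := by
    split_ifs with h
    · subst h
      simp only [real_inner_self_eq_norm_sq]
      nlinarith [hσ i]
    · rw [hcov i j h, add_zero, sq]
      exact (real_inner_le_norm _ _).trans (mul_le_mul (hβ i) (hβ j) (norm_nonneg _) hβ0)
  have hexp (z : Θ) : ‖(1 / (n : ℝ)) • ∑ i, ξ i z‖ ^ 2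
      = (1 / (n : ℝ)) ^ 2 * ∑ i, ∑ j, ⟪ξ i z, ξ j z⟫_ℝ := by
    rw [norm_smul, mul_pow, Real.norm_eq_abs, sq_abs, ← real_inner_self_eq_norm_sq, sum_inner]
    simp only [inner_sum]
  simp only [hexp]
  rw [integral_const_mul, integral_finsetSum _ fun i _ => integrable_finsetSum _ fun j _ => hint i j]
  simp only [integral_finsetSum _ fun j _ => hint _ j]
  calc (1 / (n : ℝ)) ^ 2 * ∑ i, ∑ j, ∫ z, ⟪ξ i z, ξ j z⟫_ℝ ∂ν
      ≤ (1 / (n : ℝ)) ^ 2 * ∑ i : Fin n, ∑ j : Fin n, (β ^ 2 + if i = j then σ2 else 0) := by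
        gcongr with i _ j _
        exact hterm i j
    _ = β ^ 2 + σ2 / n := by
        simp [Finset.sum_add_distrib]
        field_simp

end IndependentMean

/-! ### Regular conditional laws -/

section ConditionalLaw

variable {Ω E : Type*} [MeasurableSpace E] [StandardBorelSpace E] [Nonempty E]

theorem setLIntegral_preimage_condDistrib_prod {β : Type*} {mβ : MeasurableSpace β}
    {mΩ : MeasurableSpace Ω} {P : Measure Ω} [IsFiniteMeasure P] {X : Ω → β} {Z : Ω → E}
    (hX : Measurable X) (hZ : Measurable Z) {G : β × E → ℝ≥0∞} (hG : Measurable G) {s : Set β}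
    (hs : MeasurableSet s) :
    ∫⁻ ω in X ⁻¹' s, ∫⁻ z, G (X ω, z) ∂condDistrib Z X P (X ω) ∂P
      = ∫⁻ ω in X ⁻¹' s, G (X ω, Z ω) ∂P := by
  rw [← setLIntegral_map (f := fun b => ∫⁻ z, G (b, z) ∂condDistrib Z X P b) hs
    hG.lintegral_kernel_prod_right' hX]
  have h1 := Measure.setLIntegral_compProd (μ := P.map X) (κ := condDistrib Z X P) hG hs .univ
  rw [compProd_map_condDistrib hZ.aemeasurable, setLIntegral_map (hs.prod .univ) hG
    (hX.prodMk hZ)] at h1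
  simpa [Set.mk_preimage_prod] using h1.symm

/-- A regular conditional distribution of `Z` given the σ-algebra `𝒜`. It is the conditional
distribution of `Z` given the identity map from `Ω` to `(Ω, 𝒜)`, so that only the space `E` of the
values of `Z` has to be standard Borel. -/
noncomputable def condLaw (𝒜 : MeasurableSpace Ω) {mΩ : MeasurableSpace Ω} (P : Measure Ω)
    [IsFiniteMeasure P] (Z : Ω → E) : @Kernel Ω E 𝒜 _ :=
  @condDistrib Ω Ω E _ _ _ mΩ 𝒜 Z id P _

variable {𝒜 mΩ : MeasurableSpace Ω} {P : Measure Ω} [IsFiniteMeasure P] {Z : Ω → E}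

instance : @IsMarkovKernel Ω E 𝒜 _ (condLaw 𝒜 P Z) := by
  unfold condLaw; infer_instance

theorem condExp_comp_ae_eq_integral_condLaw (h𝒜 : 𝒜 ≤ mΩ) (hZ : Measurable Z) {g : E → ℝ}
    (hg : Measurable g) (hint : Integrable (fun ω => g (Z ω)) P) :
    P[fun ω => g (Z ω) | 𝒜] =ᵐ[P] fun ω => ∫ z, g z ∂condLaw 𝒜 P Z ω := by
  have h := @condExp_ae_eq_integral_condDistrib Ω Ω E ℝ _ _ _ _ mΩ P _ id Z 𝒜 _ _
    (measurable_id'' h𝒜) hZ.aemeasurable g hg.stronglyMeasurable hint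
  simpa [condLaw, MeasurableSpace.comap_id] using h

theorem condExp_preimage_ae_eq_condLaw (h𝒜 : 𝒜 ≤ mΩ) (hZ : Measurable Z) {s : Set E}
    (hs : MeasurableSet s) :
    P⟦Z ⁻¹' s | 𝒜⟧ =ᵐ[P] fun ω => (condLaw 𝒜 P Z ω).real s := by
  have h := @condDistrib_ae_eq_condExp Ω Ω E _ _ _ mΩ P _ id Z 𝒜 s
    (measurable_id'' h𝒜) hZ hs
  simpa [condLaw, MeasurableSpace.comap_id] using h.symm

/-- Conditional expectations given `𝒜` are integrals against the conditional law, the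
`𝒜`-measurable variables being frozen. -/
theorem condLExp_ae_eq_lintegral_condLaw {W : Type*} [MeasurableSpace W] (h𝒜 : 𝒜 ≤ mΩ)
    (hZ : Measurable Z) {w : Ω → W} (hw : Measurable[𝒜] w) {F : W × E → ℝ≥0∞}
    (hF : Measurable F) :
    condLExp 𝒜 P (fun ω => F (w ω, Z ω)) =ᵐ[P] fun ω => ∫⁻ z, F (w ω, z) ∂condLaw 𝒜 P Z ω := by
  have hG : @Measurable (Ω × E) ℝ≥0∞ (@Prod.instMeasurableSpace Ω E 𝒜 _) _
      fun p => F (w p.1, p.2) :=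
    hF.comp ((hw.comp (@measurable_fst Ω E 𝒜 _)).prodMk (@measurable_snd Ω E 𝒜 _))
  have hmeas : Measurable[𝒜] fun ω => ∫⁻ z, F (w ω, z) ∂condLaw 𝒜 P Z ω :=
    @Measurable.lintegral_kernel_prod_right' Ω E 𝒜 _ (condLaw 𝒜 P Z) _ _ hG
  refine (ae_eq_condLExp h𝒜 P _ hmeas fun s hs => ?_).symm
  exact @setLIntegral_preimage_condDistrib_prod Ω E _ _ _ Ω 𝒜 mΩ P _ id Z (measurable_id'' h𝒜) hZ
    _ hG s hs

end ConditionalLaw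

/-! ### Independence under the conditional laws -/

section ConditionalIndependence

variable {Ω E : Type*} [MeasurableSpace E] {n : ℕ}
  {𝒜 mΩ : MeasurableSpace Ω} {P : Measure Ω} [IsProbabilityMeasure P] {Z : Fin n → Ω → E}

theorem exists_countable_isPiSystem_generateFrom (E : Type*) [m : MeasurableSpace E]
    [MeasurableSpace.CountablyGenerated E] :
    ∃ 𝒞 : Set (Set E), 𝒞.Countable ∧ IsPiSystem 𝒞 ∧ m = MeasurableSpace.generateFrom 𝒞 := by
  refine ⟨generateSetAlgebra (MeasurableSpace.countableGeneratingSet E),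
    countable_generateSetAlgebra MeasurableSpace.countable_countableGeneratingSet,
    fun s hs t ht _ => isSetAlgebra_generateSetAlgebra.inter_mem hs ht, ?_⟩
  rw [generateFrom_generateSetAlgebra_eq, MeasurableSpace.generateFrom_countableGeneratingSet]

/-- Pairwise factorization, obtained with the whole space as the event of every other index. -/
theorem CondIndependent.condExp_inter (h𝒜 : 𝒜 ≤ mΩ) (hZ : CondIndependent 𝒜 P Z)
    {i j : Fin n} (hij : i ≠ j) {s t : Set E} (hs : MeasurableSet s) (ht : MeasurableSet t) :
    P⟦Z i ⁻¹' s ∩ Z j ⁻¹' t | 𝒜⟧ =ᵐ[P] fun ω => (P⟦Z i ⁻¹' s | 𝒜⟧) ω * (P⟦Z j ⁻¹' t | 𝒜⟧) ω := by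
  classical
  let S : Fin n → Set E := fun k => if k = i then s else if k = j then t else Set.univ
  have hS (k : Fin n) : MeasurableSet (S k) := by
    simp only [S]; split_ifs <;> simp [hs, ht]
  have hSi : S i = s := by simp [S]
  have hSj : S j = t := by simp [S, hij.symm]
  have hSk (k : Fin n) (hi : k ≠ i) (hj : k ≠ j) : S k = Set.univ := by simp [S, hi, hj]
  have hinter : ⋂ k, Z k ⁻¹' S k = Z i ⁻¹' s ∩ Z j ⁻¹' t := by
    ext ω
    simp only [Set.mem_iInter, Set.mem_preimage, Set.mem_inter_iff]
    refine ⟨fun h => ⟨hSi ▸ h i, hSj ▸ h j⟩, fun h k => ?_⟩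
    by_cases hi : k = i
    · rw [hi, hSi]; exact h.1
    by_cases hj : k = j
    · rw [hj, hSj]; exact h.2
    rw [hSk k hi hj]; trivial
  have h := hZ S hS
  rw [hinter] at h
  filter_upwards [h] with ω hω
  rw [hω, Finset.prod_eq_mul i j hij (fun k _ hk => ?_) (by simp) (by simp), hSi, hSj]
  rw [hSk k hk.1 hk.2, Set.preimage_univ, Set.indicator_univ, condExp_const h𝒜]

/-- Conditionally independent variables are pairwise independent under almost every conditional law:
it is enough to test the factorization on a countable π-system, so the exceptional null sets can be
united. -/
theorem CondIndependent.ae_indepFun [StandardBorelSpace E] [Nonempty E] (h𝒜 : 𝒜 ≤ mΩ)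
    (hZm : ∀ i, Measurable (Z i))
    (hZ : CondIndependent 𝒜 P Z) :
    ∀ᵐ ω ∂P, ∀ i j, i ≠ j → IndepFun (fun z : Fin n → E => z i) (fun z => z j)
      (condLaw 𝒜 P (fun ω i => Z i ω) ω) := by
  obtain ⟨𝒞, h𝒞c, h𝒞π, h𝒞⟩ := exists_countable_isPiSystem_generateFrom E
  have hm : ∀ s ∈ 𝒞, MeasurableSet s := fun s hs => by
    rw [h𝒞]; exact MeasurableSpace.measurableSet_generateFrom hs
  have hZm' : Measurable fun ω i => Z i ω := measurable_pi_lambda _ hZm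
  have key : ∀ i j, i ≠ j → ∀ s ∈ 𝒞, ∀ t ∈ 𝒞, ∀ᵐ ω ∂P,
      (condLaw 𝒜 P (fun ω i => Z i ω) ω).real
          ((fun z : Fin n → E => z i) ⁻¹' s ∩ (fun z : Fin n → E => z j) ⁻¹' t)
        = (condLaw 𝒜 P (fun ω i => Z i ω) ω).real ((fun z : Fin n → E => z i) ⁻¹' s)
          * (condLaw 𝒜 P (fun ω i => Z i ω) ω).real ((fun z : Fin n → E => z j) ⁻¹' t) := by
    intro i j hij s hs t ht
    have hsi := measurable_pi_apply (X := fun _ : Fin n => E) i (hm s hs)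
    have htj := measurable_pi_apply (X := fun _ : Fin n => E) j (hm t ht)
    filter_upwards [hZ.condExp_inter h𝒜 hij (hm s hs) (hm t ht),
      condExp_preimage_ae_eq_condLaw (P := P) h𝒜 hZm' hsi,
      condExp_preimage_ae_eq_condLaw (P := P) h𝒜 hZm' htj,
      condExp_preimage_ae_eq_condLaw (P := P) h𝒜 hZm' (hsi.inter htj)] with ω h1 h2 h3 h4
    rw [← h2, ← h3, ← h4]
    exact h1
  have key' : ∀ᵐ ω ∂P, ∀ i j, i ≠ j → ∀ s ∈ 𝒞, ∀ t ∈ 𝒞,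
      (condLaw 𝒜 P (fun ω i => Z i ω) ω).real
          ((fun z : Fin n → E => z i) ⁻¹' s ∩ (fun z : Fin n → E => z j) ⁻¹' t)
        = (condLaw 𝒜 P (fun ω i => Z i ω) ω).real ((fun z : Fin n → E => z i) ⁻¹' s)
          * (condLaw 𝒜 P (fun ω i => Z i ω) ω).real ((fun z : Fin n → E => z j) ⁻¹' t) := by
    simp only [ae_all_iff, ae_ball_iff h𝒞c]
    exact key
  filter_upwards [key'] with ω hω i j hij
  have hcomap (k : Fin n) : MeasurableSpace.comap (fun z : Fin n → E => z k) inferInstance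
      = MeasurableSpace.generateFrom (Set.preimage (fun z : Fin n → E => z k) '' 𝒞) := by
    rw [← MeasurableSpace.comap_generateFrom, ← h𝒞]
  rw [IndepFun_iff_Indep]
  refine IndepSets.indep (measurable_pi_apply i).comap_le (measurable_pi_apply j).comap_le
    (h𝒞π.comap _) (h𝒞π.comap _) (hcomap i) (hcomap j) ?_
  rw [IndepSets_iff]
  rintro _ _ ⟨s, hs, rfl⟩ ⟨t, ht, rfl⟩
  rw [← ENNReal.toReal_eq_toReal_iff' (by finiteness) (by finiteness), ENNReal.toReal_mul]
  exact hω i j hij s hs t ht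

end ConditionalIndependence

/-! ### Moments under the conditional laws -/

section ConditionalMoments

variable {Ω E H : Type*} [MeasurableSpace E] [StandardBorelSpace E] [Nonempty E]
  [NormedAddCommGroup H] [MeasurableSpace H] [BorelSpace H]
  {𝒜 mΩ : MeasurableSpace Ω} {P : Measure Ω} [IsProbabilityMeasure P] {Z : Ω → E} {u : E → H}

theorem ae_condLaw_integral_norm_sq_le (h𝒜 : 𝒜 ≤ mΩ) (hZ : Measurable Z) (hu : Measurable u)
    {r : ℝ} (hr : 0 ≤ r)
    (hb : ∀ᵐ ω ∂P, condLExp 𝒜 P (fun ω' => ENNReal.ofReal (‖u (Z ω')‖ ^ (2 : ℝ))) ω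
      ≤ ENNReal.ofReal r) :
    ∀ᵐ ω ∂P, Integrable (fun z => ‖u z‖ ^ 2) (condLaw 𝒜 P Z ω) ∧
      ∫ z, ‖u z‖ ^ 2 ∂condLaw 𝒜 P Z ω ≤ r := by
  have hF : Measurable fun p : Unit × E => ENNReal.ofReal (‖u p.2‖ ^ (2 : ℝ)) := by fun_prop
  have h := condLExp_ae_eq_lintegral_condLaw (P := P) h𝒜 hZ
    (@measurable_const _ _ _ 𝒜 ()) hF
  filter_upwards [hb, h] with ω h1 h2
  simp only [Real.rpow_two] at h1 h2
  rw [h2] at h1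
  have hm : AEStronglyMeasurable (fun z => ‖u z‖ ^ 2) (condLaw 𝒜 P Z ω) :=
    (hu.norm.pow_const 2).aestronglyMeasurable
  have h0 : 0 ≤ᵐ[condLaw 𝒜 P Z ω] fun z => ‖u z‖ ^ 2 := .of_forall fun z => by positivity
  have hint : Integrable (fun z => ‖u z‖ ^ 2) (condLaw 𝒜 P Z ω) :=
    ⟨hm, (hasFiniteIntegral_iff_ofReal h0).2 (h1.trans_lt ENNReal.ofReal_lt_top)⟩
  refine ⟨hint, ?_⟩
  rwa [← ofReal_integral_eq_lintegral_ofReal hint h0, ENNReal.ofReal_le_ofReal_iff hr] at h1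

/-- Weakly centred variables are centred under almost every conditional law, as the weak condition
may be tested on a countable dense set. -/
theorem ae_condLaw_integral_eq_zero [InnerProductSpace ℝ H] [CompleteSpace H]
    [TopologicalSpace.SeparableSpace H] (h𝒜 : 𝒜 ≤ mΩ) (hZ : Measurable Z)
    (hu : Measurable u) {r : ℝ} (hr : 0 ≤ r)
    (hb : ∀ᵐ ω ∂P, condLExp 𝒜 P (fun ω' => ENNReal.ofReal (‖u (Z ω')‖ ^ (2 : ℝ))) ω
      ≤ ENNReal.ofReal r)
    (h0 : ∀ v : H, P[fun ω => ⟪v, u (Z ω)⟫_ℝ | 𝒜] =ᵐ[P] 0) :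
    ∀ᵐ ω ∂P, ∫ z, u z ∂condLaw 𝒜 P Z ω = 0 := by
  have : SecondCountableTopology H := UniformSpace.secondCountable_of_separable H
  have hint : Integrable (fun ω => u (Z ω)) P := by
    refine integrable_of_integrable_norm_sq (hu.comp hZ).aestronglyMeasurable
      ⟨(hu.comp hZ).aestronglyMeasurable.norm.pow 2, (hasFiniteIntegral_iff_ofReal (.of_forall fun z => by positivity)).2 ?_⟩
    simp only [Real.rpow_two] at hb
    rw [← lintegral_condLExp h𝒜]
    refine (lintegral_mono_ae hb).trans_lt ?_
    simp
  have hv (v : H) : ∀ᵐ ω ∂P, ∫ z, ⟪v, u z⟫_ℝ ∂condLaw 𝒜 P Z ω = 0 := by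
    filter_upwards [h0 v, condExp_comp_ae_eq_integral_condLaw (P := P) (g := fun z => ⟪v, u z⟫_ℝ)
      h𝒜 hZ (by fun_prop) (hint.const_inner v)] with ω h1 h2
    rw [← h2, h1, Pi.zero_apply]
  have hd : ∀ᵐ ω ∂P, ∀ k, ∫ z, ⟪TopologicalSpace.denseSeq H k, u z⟫_ℝ ∂condLaw 𝒜 P Z ω = 0 :=
    ae_all_iff.2 fun k => hv _
  filter_upwards [hd, ae_condLaw_integral_norm_sq_le h𝒜 hZ hu hr hb] with ω h1 h2
  have hi : Integrable u (condLaw 𝒜 P Z ω) :=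
    integrable_of_integrable_norm_sq hu.aestronglyMeasurable h2.1
  refine (TopologicalSpace.denseRange_denseSeq H).eq_zero_of_inner_right ℝ fun k => ?_
  rw [← integral_inner hi]
  exact h1 k

end ConditionalMoments

/-! ### Mean squared error for one data set -/

section RidgeError

variable {H : Type*} [NormedAddCommGroup H] [InnerProductSpace ℝ H] [CompleteSpace H]
  [TopologicalSpace.SeparableSpace H] [MeasurableSpace H] [BorelSpace H]

/-- The constant of the error bound, in terms of the constant `c` bounding the second moments of the
displacements: the first summand accounts for the bias, `√(32 * c)` for the variance. -/
noncomputable def errorConst (c : ℝ) : ℝ :=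
  2 * (√(80 * c ^ 2 + 2 * (4 * c + √c) ^ 2) + 4 * c) + √(32 * c)

theorem errorConst_pos {c : ℝ} (hc : 0 < c) : 0 < errorConst c := by
  unfold errorConst; positivity

/-- Mean squared error of the ridge regressor for one fixed data set, when the displacements of the
covariates are drawn from a law with pairwise independent coordinates. -/
theorem lintegral_ridge_error_le {n N : ℕ} (hn : 0 < n) (hN : 0 < N) {lam c M : ℝ}
    (hlam : 0 < lam) (hc : 0 < c) (x : Fin n → H) (y : Fin n → ℝ)
    (hM : ∀ i, |y i| + ‖ridge hlam x y‖ ≤ M)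
    (κ : Measure (Fin n → H × H)) [IsProbabilityMeasure κ]
    (hind : ∀ i j, i ≠ j → IndepFun (fun z : Fin n → H × H => z i) (fun z => z j) κ)
    (ha : ∀ i, Integrable (fun z => ‖(z i).1‖ ^ 2) κ ∧ ∫ z, ‖(z i).1‖ ^ 2 ∂κ ≤ c / N)
    (hb : ∀ i, Integrable (fun z => ‖(z i).2‖ ^ 2) κ ∧ ∫ z, ‖(z i).2‖ ^ 2 ∂κ ≤ c / N ^ 2)
    (ha0 : ∀ i, ∫ z, (z i).1 ∂κ = 0) :
    ∫⁻ z, ENNReal.ofReal (‖ridge hlam x y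
        - ridge hlam (fun i => x i + ((z i).1 + (z i).2)) y‖ ^ 2) ∂κ
      ≤ ENNReal.ofReal ((errorConst c * M / (lam * N)) ^ 2
        + (errorConst c * M / (lam * √n * √N)) ^ 2) := by
  have : SecondCountableTopology H := UniformSpace.secondCountable_of_separable H
  have hN' : (1 : ℝ) ≤ N := by exact_mod_cast hN
  have hn' : (0 : ℝ) < n := by exact_mod_cast hn
  set f := ridge hlam x y with hf
  let g : Fin n → H × H → GaussRKHS H := fun i p =>
    lossGrad f (y i) (x i + (p.1 + p.2)) - lossGrad f (y i) (x i)
  have hgc (i : Fin n) : Continuous (g i) :=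
    (continuous_lossGrad f continuous_const (by fun_prop)).sub continuous_const
  have hδm (i : Fin n) : AEStronglyMeasurable (fun z : Fin n → H × H => (z i).1 + (z i).2) κ :=
    Measurable.aestronglyMeasurable (by fun_prop)
  have hδle (p : H × H) : ‖p.1 + p.2‖ ^ 2 ≤ 2 * ‖p.1‖ ^ 2 + 2 * ‖p.2‖ ^ 2 := by
    have := norm_add_le p.1 p.2
    nlinarith [sq_nonneg (‖p.1‖ - ‖p.2‖), norm_nonneg (p.1 + p.2)]
  have hδdom (i : Fin n) : Integrable (fun z : Fin n → H × H =>
      2 * ‖(z i).1‖ ^ 2 + 2 * ‖(z i).2‖ ^ 2) κ :=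
    ((ha i).1.const_mul 2).add ((hb i).1.const_mul 2)
  have hδ2 (i : Fin n) : Integrable (fun z : Fin n → H × H => ‖(z i).1 + (z i).2‖ ^ 2) κ := by
    refine (hδdom i).mono' ((hδm i).norm.pow 2) (.of_forall fun z => ?_)
    rw [Real.norm_of_nonneg (by positivity)]
    exact hδle (z i)
  have hδA (i : Fin n) : ∫ z, ‖(z i).1 + (z i).2‖ ^ 2 ∂κ ≤ 4 * c / N := by
    refine (integral_mono (hδ2 i) (hδdom i) fun z => hδle (z i)).trans ?_
    rw [integral_add ((ha i).1.const_mul 2) ((hb i).1.const_mul 2), integral_const_mul,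
      integral_const_mul]
    have h1 : c / (N : ℝ) ^ 2 ≤ c / N := by
      gcongr; nlinarith
    have h2 : 4 * c / (N : ℝ) = 4 * (c / N) := by ring
    linarith [(ha i).2, (hb i).2]
  -- only the small part `(z i).2` of the displacement contributes to its mean
  have hδB (i : Fin n) : ‖∫ z, ((z i).1 + (z i).2) ∂κ‖ ≤ √c / N := by
    have hai : Integrable (fun z : Fin n → H × H => (z i).1) κ :=
      integrable_of_integrable_norm_sq (Measurable.aestronglyMeasurable (by fun_prop)) (ha i).1
    have hbm : AEStronglyMeasurable (fun z : Fin n → H × H => (z i).2) κ :=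
      Measurable.aestronglyMeasurable (by fun_prop)
    have hbi := integrable_of_integrable_norm_sq hbm (hb i).1
    rw [integral_add hai hbi, ha0 i, zero_add]
    have h := Real.le_sqrt_of_sq_le ((norm_integral_sq_le hbm (hb i).1).trans (hb i).2)
    rwa [Real.sqrt_div hc.le, Real.sqrt_sq (by positivity)] at h
  have hξm (i : Fin n) : AEStronglyMeasurable (fun z : Fin n → H × H => g i (z i)) κ :=
    aestronglyMeasurable_lossGrad_increment f (y i) (x i) (hδm i)
  have hξ2 (i : Fin n) : Integrable (fun z : Fin n → H × H => ‖g i (z i)‖ ^ 2) κ :=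
    integrable_norm_lossGrad_increment_sq f (y i) (x i) (hδm i) (hδ2 i)
  have hcov (i j : Fin n) (hij : i ≠ j) : ∫ z, ⟪g i (z i), g j (z j)⟫_ℝ ∂κ
      = ⟪∫ z, g i (z i) ∂κ, ∫ z, g j (z j) ∂κ⟫_ℝ := by
    have hi (k : Fin n) : Integrable (g k) (κ.map fun z => z k) :=
      (integrable_map_measure (hgc k).aestronglyMeasurable (measurable_pi_apply k).aemeasurable).2
        (integrable_of_integrable_norm_sq (hξm k) (hξ2 k))
    exact (hind i j hij).integral_bilin_comp_comp (measurable_pi_apply i).aemeasurable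
      (measurable_pi_apply j).aemeasurable (hi i) (hi j) (innerSL ℝ)
  have hmean := integral_norm_average_sq_le hn hξm hξ2 hcov
    (fun i => norm_integral_lossGrad_increment_le f (hM i) (x i) (hδm i) (hδ2 i) (hδA i) (hδB i))
    (fun i => integral_norm_lossGrad_increment_sq_le f (hM i) (x i) (hδm i) (hδ2 i) (hδA i))
  have hmeanL : MemLp (fun z : Fin n → H × H => (1 / (n : ℝ)) • ∑ i, g i (z i)) 2 κ :=
    MemLp.const_smul (f := fun z : Fin n → H × H => ∑ i, g i (z i)) (memLp_finsetSum _ fun i _ =>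
      (memLp_two_iff_integrable_sq_norm (hξm i)).2 (hξ2 i)) (1 / (n : ℝ))
  have hmean2 := (memLp_two_iff_integrable_sq_norm hmeanL.1).1 hmeanL
  have hpt (z : Fin n → H × H) :
      ‖f - ridge hlam (fun i => x i + ((z i).1 + (z i).2)) y‖ ^ 2
        ≤ (lam ^ 2)⁻¹ * ‖(1 / (n : ℝ)) • ∑ i, g i (z i)‖ ^ 2 := by
    have h := ridge_stability hlam x (fun i => x i + ((z i).1 + (z i).2)) y y
    rw [le_inv_mul_iff₀ (by positivity), ← mul_pow]
    gcongr
  have hM0 : 0 ≤ M := le_trans (by positivity) (hM ⟨0, hn⟩)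
  refine (lintegral_mono fun z => ENNReal.ofReal_le_ofReal (hpt z)).trans ?_
  rw [← ofReal_integral_eq_lintegral_ofReal (hmean2.const_mul _)
    (.of_forall fun z => by positivity), integral_const_mul]
  refine ENNReal.ofReal_le_ofReal ?_
  refine (mul_le_mul_of_nonneg_left hmean (by positivity)).trans ?_
  set D := √(80 * c ^ 2 + 2 * (4 * c + √c) ^ 2) with hD
  -- the bias is of order `1 / N`, as both bounds `4 * c / N` and `√c / N` on the moments are
  have hsqrt : √(5 * (4 * c / N) ^ 2 + 2 * (4 * c / N + √c / N) ^ 2) = D / N := by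
    have : 5 * (4 * c / N) ^ 2 + 2 * (4 * c / N + √c / N) ^ 2
        = (80 * c ^ 2 + 2 * (4 * c + √c) ^ 2) / (N : ℝ) ^ 2 := by
      field_simp; ring
    rw [this, Real.sqrt_div (by positivity), Real.sqrt_sq (by positivity)]
  have hD0 : 0 ≤ D := Real.sqrt_nonneg _
  have hE1 : 2 * (D + 4 * c) ≤ errorConst c := le_add_of_nonneg_right (Real.sqrt_nonneg _)
  have hE2 : 32 * c ≤ errorConst c ^ 2 := by
    rw [← Real.sqrt_le_left (errorConst_pos hc).le]
    exact le_add_of_nonneg_left (by positivity)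
  have e1 : (lam ^ 2)⁻¹ * (2 * M * (D / N + 4 * c / N)) ^ 2
      ≤ (errorConst c * M / (lam * N)) ^ 2 := by
    have : (lam ^ 2)⁻¹ * (2 * M * (D / N + 4 * c / N)) ^ 2
        = (2 * (D + 4 * c) * M / (lam * N)) ^ 2 := by
      field_simp
    rw [this]
    gcongr
  have e2 : (lam ^ 2)⁻¹ * (8 * M ^ 2 * (4 * c / N) / n)
      ≤ (errorConst c * M / (lam * √n * √N)) ^ 2 := by
    have h1 : (lam ^ 2)⁻¹ * (8 * M ^ 2 * (4 * c / N) / n)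
        = 32 * c * M ^ 2 / (lam ^ 2 * n * N) := by
      field_simp; ring
    have h2 : (errorConst c * M / (lam * √n * √N)) ^ 2
        = errorConst c ^ 2 * M ^ 2 / (lam ^ 2 * n * N) := by
      rw [div_pow, mul_pow, mul_pow, mul_pow, Real.sq_sqrt hn'.le, Real.sq_sqrt (by positivity)]
    rw [h1, h2]
    gcongr
  rw [hsqrt, mul_add]
  exact add_le_add e1 e2

end RidgeError

end KernelRidge

/-! ### The error bound -/

theorem theorem1 {H : Type*} [NormedAddCommGroup H] [InnerProductSpace ℝ H] [CompleteSpace H]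
    [TopologicalSpace.SeparableSpace H] [MeasurableSpace H] [BorelSpace H]
    (c : ℝ → ℝ) (hc : ∀ s, 0 < s → 0 < c s) :
    ∃ C : ℝ, 0 < C ∧
      ∀ {Ω : Type*} (𝒜 : MeasurableSpace Ω) {mΩ : MeasurableSpace Ω} (_h𝒜 : 𝒜 ≤ mΩ)
        (P : Measure Ω) [IsProbabilityMeasure P]
        (n N : ℕ) (_hn : 0 < n) (_hN : 0 < N) (lam : ℝ) (hlam : 0 < lam)
        (x xN : Fin n → Ω → H) (Y : Fin n → Ω → ℝ)
        (_hx : ∀ i, Measurable[𝒜] (x i)) (_hY : ∀ i, Measurable[𝒜] (Y i))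
        (_hxN : ∀ i, Measurable[mΩ] (xN i))
        (_hunb : NearUnbiased 𝒜 P N x xN c)
        (fn fnN : Ω → GaussRKHS H)
        (_hfn : ∀ ω, fn ω = ridge hlam (fun i => x i ω) (fun i => Y i ω))
        (_hfnN : ∀ ω, fnN ω = ridge hlam (fun i => xN i ω) (fun i => Y i ω))
        (Ymax cn : Ω → ℝ)
        (_hYmax : ∀ ω, Ymax ω = ⨆ i, |Y i ω|) (_hcn : ∀ ω, cn ω = ‖fn ω‖),
        ∀ᵐ ω ∂P,
          (condLExp 𝒜 P (fun ω' => ENNReal.ofReal (‖fn ω' - fnN ω'‖ ^ 2)) ω) ^ (1 / 2 : ℝ)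
            ≤ ENNReal.ofReal
              (C * (Ymax ω + cn ω) / (lam * N)
                + C * (Ymax ω + cn ω) / (lam * √n * √N)
                + (1 + √N / √n)⁻¹
                  * (C * (Ymax ω + cn ω) / (lam * n)
                    + C * (Ymax ω + cn ω) / (lam ^ 2 * n * √N))) := by

  have : SecondCountableTopology H := UniformSpace.secondCountable_of_separable H
  have hc2 := hc 2 two_pos
  refine ⟨errorConst (c 2), errorConst_pos hc2, ?_⟩
  intro Ω 𝒜 mΩ h𝒜 P _ n N hn hN lam hlam x xN Y hx hY hxN hunb fn fnN hfn hfnN Ymax cn hYmax hcn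
  have hN' : (0 : ℝ) < N := by exact_mod_cast hN
  have hn' : (0 : ℝ) < n := by exact_mod_cast hn
  -- second moments suffice
  obtain ⟨a, b, ham, hbm, hab, hind, ha, hb, ha0⟩ := hunb 2 two_pos
  let Z : Ω → Fin n → H × H := fun ω i => (a i ω, b i ω)
  have hZ : Measurable Z := measurable_pi_lambda _ fun i => (ham i).prodMk (hbm i)
  let w : Ω → (Fin n → H) × (Fin n → ℝ) := fun ω => (fun i => x i ω, fun i => Y i ω)
  have hw : Measurable[𝒜] w :=
    @Measurable.prodMk _ 𝒜 _ _ _ _ _ _ (@measurable_pi_lambda _ _ _ 𝒜 _ _ hx)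
      (@measurable_pi_lambda _ _ _ 𝒜 _ _ hY)
  let F : ((Fin n → H) × (Fin n → ℝ)) × (Fin n → H × H) → ℝ≥0∞ := fun p =>
    ENNReal.ofReal (‖ridge hlam p.1.1 p.1.2
      - ridge hlam (fun i => p.1.1 i + ((p.2 i).1 + (p.2 i).2)) p.1.2‖ ^ 2)
  have hF : Measurable F := by
    have h1 : Continuous fun p : ((Fin n → H) × (Fin n → ℝ)) × (Fin n → H × H) =>
        ridge hlam p.1.1 p.1.2 := (continuous_ridge hlam).comp continuous_fst
    have h2 : Continuous fun p : ((Fin n → H) × (Fin n → ℝ)) × (Fin n → H × H) =>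
        ridge hlam (fun i => p.1.1 i + ((p.2 i).1 + (p.2 i).2)) p.1.2 :=
      (continuous_ridge hlam).comp (g := fun p : (Fin n → H) × (Fin n → ℝ) => ridge hlam p.1 p.2)
        (f := fun p : ((Fin n → H) × (Fin n → ℝ)) × (Fin n → H × H) =>
          (fun i => p.1.1 i + ((p.2 i).1 + (p.2 i).2), p.1.2)) (by fun_prop)
    exact (ENNReal.continuous_ofReal.comp ((h1.sub h2).norm.pow 2)).measurable
  -- the error is a function of the `𝒜`-measurable data `w` and of the displacements `Z`
  have herr : (fun ω => ENNReal.ofReal (‖fn ω - fnN ω‖ ^ 2)) =ᵐ[P] fun ω => F (w ω, Z ω) := by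
    filter_upwards [ae_all_iff.2 hab] with ω hω
    have : (fun i => xN i ω) = fun i => x i ω + (a i ω + b i ω) := by
      funext i; rw [← hω i]; abel
    simp only [F, w, Z]
    rw [hfn, hfnN, this]
  have hZi (i : Fin n) : Measurable fun ω => Z ω i := (ham i).prodMk (hbm i)
  have ha' := fun i => ae_condLaw_integral_norm_sq_le (P := P) (u := fun z : Fin n → H × H => (z i).1)
    h𝒜 hZ (by fun_prop) (r := c 2 / N) (by positivity) (by simpa using ha i)
  have hb' := fun i => ae_condLaw_integral_norm_sq_le (P := P) (u := fun z : Fin n → H × H => (z i).2)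
    h𝒜 hZ (by fun_prop) (r := c 2 / N ^ 2) (by positivity) (by simpa using hb i)
  have ha0' := fun i => ae_condLaw_integral_eq_zero (P := P) (u := fun z : Fin n → H × H => (z i).1)
    h𝒜 hZ (by fun_prop) (r := c 2 / N) (by positivity) (by simpa using ha i) (ha0 i)
  filter_upwards [condLExp_congr_ae (mΩ := 𝒜) herr,
    condLExp_ae_eq_lintegral_condLaw (P := P) h𝒜 hZ hw hF, hind.ae_indepFun h𝒜 hZi,
    ae_all_iff.2 ha', ae_all_iff.2 hb', ae_all_iff.2 ha0'] with ω h1 h2 h3 h4 h5 h6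
  rw [h1, h2]
  have hY0 (i : Fin n) : |Y i ω| ≤ Ymax ω := by
    rw [hYmax]; exact le_ciSup (Set.finite_range fun i => |Y i ω|).bddAbove i
  have hM (i : Fin n) : |Y i ω| + ‖ridge hlam (fun i => x i ω) (fun i => Y i ω)‖
      ≤ Ymax ω + cn ω := by
    rw [hcn, hfn]; exact add_le_add (hY0 i) le_rfl
  have hM0 : 0 ≤ Ymax ω + cn ω := le_trans (by positivity) (hM ⟨0, hn⟩)
  have hC := errorConst_pos hc2
  have hmain := lintegral_ridge_error_le hn hN hlam hc2 (fun i => x i ω) (fun i => Y i ω) hM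
    (condLaw 𝒜 P Z ω) h3 h4 h5 h6
  set C := errorConst (c 2)
  set M := Ymax ω + cn ω
  set t1 := C * M / (lam * N)
  set t2 := C * M / (lam * √n * √N)
  have ht1 : 0 ≤ t1 := by positivity
  have ht2 : 0 ≤ t2 := by positivity
  have ht3 : 0 ≤ (1 + √N / √n)⁻¹ * (C * M / (lam * n) + C * M / (lam ^ 2 * n * √N)) := by
    positivity
  calc (∫⁻ z, F (w ω, z) ∂condLaw 𝒜 P Z ω) ^ (1 / 2 : ℝ)
      ≤ (ENNReal.ofReal ((t1 + t2) ^ 2)) ^ (1 / 2 : ℝ) := by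
        refine ENNReal.rpow_le_rpow (hmain.trans (ENNReal.ofReal_le_ofReal ?_)) (by norm_num)
        nlinarith
    _ = ENNReal.ofReal (t1 + t2) := by
        rw [ENNReal.ofReal_rpow_of_nonneg (by positivity) (by norm_num), ← Real.sqrt_eq_rpow,
          Real.sqrt_sq (by positivity)]
    _ ≤ _ := ENNReal.ofReal_le_ofReal (le_add_of_nonneg_right ht3)
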